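/- Let $\mathbb{E}$ be a regular category, i.e. a category with finite limits in which regular epimorphisms are stable under pullback and every kernel pair has a coequalizer. For an object $Y$ of $\mathbb{E}$, let $\mathsf{Pt}_Y\mathbb{E}$ be the fibre above $Y$ of the fibration of points: its objects are the split epimorphisms $f\colon X\to Y$ equipped with a given section $s\colon Y\to X$ ($f s=1_Y$), and a morphism $(X,f,s)\to(\bar X,\bar f,\bar s)$ is a morphism $h\colon X\to\bar X$ with $\bar f h=f$ and $h s=\bar s$. For $q\colon Y'\to Y$, let $q^*\colon \mathsf{Pt}_Y\mathbb{E}\to\mathsf{Pt}_{Y'}\mathbb{E}$ be the base-change functor given by pullback along $q$. A functor $F\colon\mathbb{C}\to\mathbb{D}$ is called saturated on subobjects when for every object $X$ of $\mathbb{C}$ and every monomorphism $n\colon Z\to F(X)$ in $\mathbb{D}$ there are a monomorphism $m\colon W\to X$ in $\mathbb{C}$ and an isomorphism $e\colon Z\to F(W)$ such that $F(m)\,e=n$. Theorem. The regular category $\mathbb{E}$ is a Mal'tsev category (i.e. it is finitely complete and every internal reflexive relation in $\mathbb{E}$ is an internal equivalence relation) if and only if, for every regular epimorphism $q\colon Y'\to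 Y$ in $\mathbb{E}$, the functor $q^*\colon \mathsf{Pt}_Y\mathbb{E}\to\mathsf{Pt}_{Y'}\mathbb{E}$ is fully faithful and saturated on subobjects. -/

import Mathlib

open CategoryTheory CategoryTheory.Limits

universe v u v' u'

namespace MaltsevCat

/-- A category is a *Mal'tsev category* if it is finitely complete and every internal reflexive
relation (a jointly monic pair `p₁, p₂ : R ⟶ X` with a common section) is an internal equivalence
relation. -/
class IsMaltsev (E : Type u) [Category.{v} E] : Prop extends HasFiniteLimits E where
  isEquivalenceRelation : ∀ {R X : E} (p₁ p₂ : R ⟶ X),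
    ReflexiveRelation p₁ p₂ → IsEquivalenceRelation p₁ p₂

/-- An object of the fibre `Pt_Y(E)` of the fibration of points: a split epimorphism `f : X ⟶ Y`
equipped with a given section `s : Y ⟶ X`. -/
structure Pt {E : Type u} [Category.{v} E] (Y : E) where
  X : E
  f : X ⟶ Y
  s : Y ⟶ X
  s_f : s ≫ f = 𝟙 Y

namespace Pt

variable {E : Type u} [Category.{v} E]

attribute [simp] Pt.s_f

/-- A morphism of `Pt_Y(E)`: a morphism commuting with the split epimorphisms and with the given
sections (so lying over the identity of `Y`). -/
@[ext]
structure Hom {Y : E} (P Q : Pt Y) where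
  hom : P.X ⟶ Q.X
  hom_f : hom ≫ Q.f = P.f
  s_hom : P.s ≫ hom = Q.s

attribute [simp] Hom.hom_f Hom.s_hom

instance (Y : E) : Category.{v} (Pt Y) where
  Hom P Q := Hom P Q
  id P := { hom := 𝟙 P.X, hom_f := by simp, s_hom := by simp }
  comp {P Q R} g h :=
    { hom := Hom.hom g ≫ Hom.hom h
      hom_f := by rw [Category.assoc, Hom.hom_f, Hom.hom_f]
      s_hom := by rw [← Category.assoc, Hom.s_hom, Hom.s_hom] }
  id_comp g := Hom.ext (Category.id_comp (Hom.hom g))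
  comp_id g := Hom.ext (Category.comp_id (Hom.hom g))
  assoc g h k := Hom.ext (Category.assoc (Hom.hom g) (Hom.hom h) (Hom.hom k))

@[ext]
theorem hom_ext {Y : E} {P Q : Pt Y} {g h : P ⟶ Q} (w : Hom.hom g = Hom.hom h) : g = h :=
  Hom.ext w

@[simp]
theorem id_hom {Y : E} (P : Pt Y) : Hom.hom (𝟙 P) = 𝟙 P.X := rfl

@[simp]
theorem comp_hom {Y : E} {P Q R : Pt Y} (g : P ⟶ Q) (h : Q ⟶ R) :
    Hom.hom (g ≫ h) = Hom.hom g ≫ Hom.hom h := rfl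

variable [HasPullbacks E]

/-- The section of `X ×_Y Y' ⟶ Y'` induced by the section `s` of a point `(f, s)` over `Y`. -/
noncomputable def pullbackSection {Y' Y : E} (q : Y' ⟶ Y) (P : Pt Y) : Y' ⟶ pullback P.f q :=
  pullback.lift (q ≫ P.s) (𝟙 Y') (by simp)

@[simp]
theorem pullbackSection_fst {Y' Y : E} (q : Y' ⟶ Y) (P : Pt Y) :
    pullbackSection q P ≫ pullback.fst P.f q = q ≫ P.s :=
  pullback.lift_fst _ _ _

@[simp]
theorem pullbackSection_snd {Y' Y : E} (q : Y' ⟶ Y) (P : Pt Y) :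
    pullbackSection q P ≫ pullback.snd P.f q = 𝟙 Y' :=
  pullback.lift_snd _ _ _

/-- The morphism `g ×_Y Y'` between pullbacks induced by a morphism `g` of points over `Y`. -/
noncomputable def pullbackHom {Y' Y : E} (q : Y' ⟶ Y) {P Q : Pt Y} (g : P ⟶ Q) :
    pullback P.f q ⟶ pullback Q.f q :=
  pullback.lift (pullback.fst P.f q ≫ Hom.hom g) (pullback.snd P.f q)
    (by rw [Category.assoc, Hom.hom_f, pullback.condition])

@[simp]
theorem pullbackHom_fst {Y' Y : E} (q : Y' ⟶ Y) {P Q : Pt Y} (g : P ⟶ Q) :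
    pullbackHom q g ≫ pullback.fst Q.f q = pullback.fst P.f q ≫ Hom.hom g :=
  pullback.lift_fst _ _ _

@[simp]
theorem pullbackHom_snd {Y' Y : E} (q : Y' ⟶ Y) {P Q : Pt Y} (g : P ⟶ Q) :
    pullbackHom q g ≫ pullback.snd Q.f q = pullback.snd P.f q :=
  pullback.lift_snd _ _ _

theorem pullbackSection_pullbackHom {Y' Y : E} (q : Y' ⟶ Y) {P Q : Pt Y} (g : P ⟶ Q) :
    pullbackSection q P ≫ pullbackHom q g = pullbackSection q Q := by
  apply pullback.hom_ext
  · rw [Category.assoc, pullbackHom_fst, ← Category.assoc, pullbackSection_fst, Category.assoc,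
      Hom.s_hom, pullbackSection_fst]
  · rw [Category.assoc, pullbackHom_snd, pullbackSection_snd, pullbackSection_snd]

theorem pullbackHom_id {Y' Y : E} (q : Y' ⟶ Y) (P : Pt Y) :
    pullbackHom q (𝟙 P) = 𝟙 (pullback P.f q) := by
  apply pullback.hom_ext
  · rw [pullbackHom_fst, id_hom, Category.comp_id, Category.id_comp]
  · rw [pullbackHom_snd, Category.id_comp]

theorem pullbackHom_comp {Y' Y : E} (q : Y' ⟶ Y) {P Q R : Pt Y} (g : P ⟶ Q) (h : Q ⟶ R) :
    pullbackHom q (g ≫ h) = pullbackHom q g ≫ pullbackHom q h := by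
  apply pullback.hom_ext
  · rw [pullbackHom_fst, comp_hom, Category.assoc, pullbackHom_fst, ← Category.assoc,
      ← Category.assoc, pullbackHom_fst]
  · rw [pullbackHom_snd, Category.assoc, pullbackHom_snd, pullbackHom_snd]

/-- The base-change functor `q^* : Pt_Y(E) ⥤ Pt_{Y'}(E)` of the fibration of points along
`q : Y' ⟶ Y`, obtained by pullback along `q`. -/
noncomputable def baseChange {Y' Y : E} (q : Y' ⟶ Y) : Pt Y ⥤ Pt Y' where
  obj P :=
    { X := pullback P.f q
      f := pullback.snd P.f q
      s := pullbackSection q P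
      s_f := pullbackSection_snd q P }
  map g :=
    { hom := pullbackHom q g
      hom_f := pullbackHom_snd q g
      s_hom := pullbackSection_pullbackHom q g }
  map_id P := hom_ext (pullbackHom_id q P)
  map_comp g h := hom_ext (pullbackHom_comp q g h)

end Pt

/-- A functor `F` is *saturated on subobjects* if every monomorphism `n : Z ⟶ F X` is, up to
isomorphism (of subobjects of `F X`), the image under `F` of a monomorphism `m : W ⟶ X`. -/
def SaturatedOnSubobjects {C : Type u} [Category.{v} C] {D : Type u'} [Category.{v'} D]
    (F : C ⥤ D) : Prop :=
  ∀ (X : C) (Z : D) (n : Z ⟶ F.obj X), Mono n →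
    ∃ (W : C) (m : W ⟶ X) (e : Z ≅ F.obj W), Mono m ∧ e.hom ≫ F.map m = n

end MaltsevCat

namespace MaltsevCat

variable {E : Type u} [Category.{v} E]

attribute [local simp] pullback.lift_fst pullback.lift_snd pullback.lift_fst_assoc
  pullback.lift_snd_assoc Limits.prod.lift_fst Limits.prod.lift_snd Limits.prod.lift_fst_assoc
  Limits.prod.lift_snd_assoc

/-! Both directions pass through difunctionality: a finitely complete category is Mal'tsev exactly
when all its relations are difunctional. If `E` is Mal'tsev and `q` is a regular epimorphism,
fullness asks that a map out of `q^*P` not depend on the choice of `y` over `q y`, and saturation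
asks the same of membership in a subobject of `q^*P`. In both cases the claim is known at the points
of the section, and difunctionality carries it to an arbitrary `x`. Faithfulness holds because
regular epimorphisms are stable under pullback. Conversely, for a reflexive relation `R`, saturation
along `p₁` says that a certain predicate on `r` in `R` depends only on `p₁ r`; this is
difunctionality of `R`. -/

/-- The difunctionality of a span, expressed with generalized elements: from `a W d`, `c W d` and
`c W b` one gets `a W b`. -/
def Difunctional {W A B : E} (p : W ⟶ A) (q : W ⟶ B) : Prop :=
  ∀ ⦃Z : E⦄ (w₁ w₂ w₃ : Z ⟶ W), w₁ ≫ q = w₂ ≫ q → w₂ ≫ p = w₃ ≫ p →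
    ∃ w : Z ⟶ W, w ≫ p = w₁ ≫ p ∧ w ≫ q = w₃ ≫ q

/-! ### Mal'tsev categories and difunctional relations -/

/-- A difunctional reflexive relation is an equivalence relation. -/
theorem Difunctional.isEquivalenceRelation [HasPullbacks E] {R X : E} {p₁ p₂ : R ⟶ X}
    (hd : Difunctional p₁ p₂) (h : ReflexiveRelation p₁ p₂) : IsEquivalenceRelation p₁ p₂ := by
  -- For `x R y`, apply difunctionality to `(y, y)`, `(x, y)`, `(x, x)`.
  obtain ⟨s, hs₁, hs₂⟩ := hd (p₂ ≫ h.r) (𝟙 R) (p₁ ≫ h.r) (by simp) (by simp)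
  -- For `x R y` and `y R z`, apply it to `(x, y)`, `(y, y)`, `(y, z)`.
  obtain ⟨t, ht₁, ht₂⟩ := hd (pullback.fst p₂ p₁) (pullback.fst p₂ p₁ ≫ p₂ ≫ h.r)
    (pullback.snd p₂ p₁) (by simp) (by simp [pullback.condition])
  exact ⟨⟨{ h with
    s := s
    symmetry₁ := by simpa using hs₁
    symmetry₂ := by simpa using hs₂
    c := _
    isLimit := pullback.isLimit p₂ p₁
    t := t
    transitivity₁ := ht₁
    transitivity₂ := ht₂ }⟩⟩

/-- In a Mal'tsev category every relation is difunctional. -/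
theorem IsMaltsev.difunctional [IsMaltsev E] {W A B : E} (p : W ⟶ A) (q : W ⟶ B)
    (hW : JointlyMono₂ p q) : Difunctional p q := by
  intro Z w₁ w₂ w₃ hq hp
  -- The reflexive relation on `W` in which `u ~ v` means that `(p u, q v)` lies in `W`; `k` gives
  -- the pair `(u, v)` and `l` the witness in `W`.
  let k := pullback.snd (prod.lift p q) (prod.map p q)
  let l := pullback.fst (prod.lift p q) (prod.map p q)
  have hl₁ : l ≫ p = (k ≫ prod.fst) ≫ p := by
    have := pullback.condition (f := prod.lift p q) (g := prod.map p q) =≫ prod.fst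
    simpa [k, l] using this
  have hl₂ : l ≫ q = (k ≫ prod.snd) ≫ q := by
    have := pullback.condition (f := prod.lift p q) (g := prod.map p q) =≫ prod.snd
    simpa [k, l] using this
  have href : ReflexiveRelation (k ≫ prod.fst) (k ≫ prod.snd) :=
    { right_cancellation := fun V f g h₁ h₂ => by
        have hk : f ≫ k = g ≫ k := by
          apply Limits.prod.hom_ext
          · simpa using h₁
          · simpa using h₂
        refine pullback.hom_ext (hW.right_cancellation _ _ ?_ ?_) hk
        · change (f ≫ l) ≫ p = (g ≫ l) ≫ p
          simp only [Category.assoc, hl₁, reassoc_of% hk]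
        · change (f ≫ l) ≫ q = (g ≫ l) ≫ q
          simp only [Category.assoc, hl₂, reassoc_of% hk]
      r := pullback.lift (𝟙 W) (diag W) (by ext <;> simp)
      reflexivity₁ := by simp [k]
      reflexivity₂ := by simp [k] }
  obtain ⟨⟨e⟩⟩ := IsMaltsev.isEquivalenceRelation _ _ href
  -- `w₂` witnesses `w₃ ~ w₁`; by symmetry `w₁ ~ w₃`, whose witness is the required element.
  let z : Z ⟶ pullback (prod.lift p q) (prod.map p q) :=
    pullback.lift w₂ (prod.lift w₃ w₁) (by ext <;> simp [hp, hq])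
  refine ⟨z ≫ e.s ≫ l, ?_, ?_⟩
  · rw [Category.assoc, Category.assoc, hl₁, e.symmetry₁_assoc]
    simp [z, k]
  · rw [Category.assoc, Category.assoc, hl₂, e.symmetry₂_assoc]
    simp [z, k]

/-! ### Base change along a regular epimorphism -/

/-- A monomorphism of points is a monomorphism of the underlying objects. -/
theorem Pt.mono_hom [HasPullbacks E] {Y : E} {P Q : Pt Y} (n : P ⟶ Q) [Mono n] :
    Mono (Hom.hom n) := by
  -- The kernel pair of `n` formed in `E` is itself a point over `Y`, so `n` can be cancelled in the
  -- fibre.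
  let K : Pt Y :=
    { X := pullback (Hom.hom n) (Hom.hom n)
      f := pullback.fst _ _ ≫ P.f
      s := pullback.lift P.s P.s rfl
      s_f := by simp }
  let a : K ⟶ P := Hom.mk (pullback.fst (Hom.hom n) (Hom.hom n)) rfl (by simp [K])
  let b : K ⟶ P := Hom.mk (pullback.snd (Hom.hom n) (Hom.hom n))
    (by simp only [K]; rw [← Hom.hom_f n, ← pullback.condition_assoc]) (by simp [K])
  have hab : a = b := by
    rw [← cancel_mono n]
    exact hom_ext pullback.condition
  exact (IsKernelPair.of_hasPullback _).mono_of_eq_fst_snd (congrArg Hom.hom hab)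

/-- Base change of points along a regular epimorphism of a regular category is faithful. -/
theorem Pt.baseChange_faithful [Regular E] {Y' Y : E} (q : Y' ⟶ Y) [IsRegularEpi q] :
    (baseChange q).Faithful where
  map_injective {P Q g h} w := by
    apply hom_ext
    have : pullbackHom q g = pullbackHom q h := congrArg Hom.hom w
    rw [← cancel_epi (pullback.fst P.f q), ← pullbackHom_fst, ← pullbackHom_fst, this]

/-- In a regular Mal'tsev category, base change of points along a regular epimorphism is full. -/
theorem Pt.baseChange_full [Regular E] [IsMaltsev E] {Y' Y : E} (q : Y' ⟶ Y) [IsRegularEpi q] :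
    (baseChange q).Full where
  map_surjective {P Q} g := by
    let π : pullback P.f q ⟶ P.X := pullback.fst P.f q
    let f' : pullback P.f q ⟶ Y' := pullback.snd P.f q
    let φ : pullback P.f q ⟶ Q.X := Hom.hom g ≫ pullback.fst Q.f q
    have hw : π ≫ P.f = f' ≫ q := pullback.condition
    have hgf : Hom.hom g ≫ pullback.snd Q.f q = f' := Hom.hom_f g
    have hgs : pullbackSection q P ≫ φ = q ≫ Q.s := by
      have h : pullbackSection q P ≫ Hom.hom g = pullbackSection q Q := Hom.s_hom g
      rw [← pullbackSection_fst, ← h]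
      exact (Category.assoc _ _ _).symm
    let k₁ := pullback.fst π π
    let k₂ := pullback.snd π π
    have hk : k₁ ≫ π = k₂ ≫ π := pullback.condition
    -- An element of the kernel pair of `π` is a triple `(x, y, y')` with `f x = q y = q y'`. The
    -- triples on which `φ (x, y) = φ (x, y')` form a relation between `P.X` and `Y' ⨯ Y'`; the aim
    -- is that it contains every triple.
    let ι := equalizer.ι (k₁ ≫ φ) (k₂ ≫ φ)
    let b := prod.lift (k₁ ≫ f') (k₂ ≫ f')
    have hmono : JointlyMono₂ (ι ≫ k₁ ≫ π) (ι ≫ b) := ⟨fun V x y h₁ h₂ => by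
      rw [← cancel_mono ι]
      have h₃ := h₂ =≫ prod.fst
      have h₄ := h₂ =≫ prod.snd
      simp only [b, Category.assoc, prod.lift_fst, prod.lift_snd] at h₃ h₄
      have h₅ := h₁
      rw [hk] at h₅
      apply pullback.hom_ext <;> apply pullback.hom_ext
      · simpa [π] using h₁
      · simpa [f'] using h₃
      · simpa [π] using h₅
      · simpa [f'] using h₄⟩
    have hd := IsMaltsev.difunctional _ _ hmono
    -- the points `(x, y, y)`, `(s (q y), y, y)` and `(s (q y), y, y')` of the relation
    let d : pullback P.f q ⟶ equalizer (k₁ ≫ φ) (k₂ ≫ φ) :=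
      equalizer.lift (pullback.lift (𝟙 _) (𝟙 _) rfl) (by simp [k₁, k₂])
    have hdι : d ≫ ι = pullback.lift (𝟙 _) (𝟙 _) rfl := equalizer.lift_ι _ _
    have hqq : (k₁ ≫ f') ≫ q = (k₂ ≫ f') ≫ q := by
      rw [Category.assoc, Category.assoc, ← hw, reassoc_of% hk]
    let σ : pullback π π ⟶ pullback π π :=
      pullback.lift ((k₁ ≫ f') ≫ pullbackSection q P) ((k₂ ≫ f') ≫ pullbackSection q P) (by
        simp only [π, Category.assoc, pullbackSection_fst]
        simpa using hqq =≫ P.s)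
    -- On the section `φ` is `q ≫ Q.s`, which takes the same value at `y` and `y'`.
    let c : pullback π π ⟶ equalizer (k₁ ≫ φ) (k₂ ≫ φ) := equalizer.lift σ (by
      have h₁ : σ ≫ k₁ = (k₁ ≫ f') ≫ pullbackSection q P := pullback.lift_fst _ _ _
      have h₂ : σ ≫ k₂ = (k₂ ≫ f') ≫ pullbackSection q P := pullback.lift_snd _ _ _
      rw [reassoc_of% h₁, reassoc_of% h₂, hgs, reassoc_of% hqq])
    have hcι : c ≫ ι = σ := equalizer.lift_ι _ _
    obtain ⟨w, hw₁, hw₂⟩ := hd (k₁ ≫ d) (k₁ ≫ f' ≫ pullbackSection q P ≫ d) c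
      (by
        simp only [Category.assoc, reassoc_of% hdι]
        apply Limits.prod.hom_ext <;> simp [b, k₁, k₂, f'])
      (by
        simp only [Category.assoc, reassoc_of% hdι, reassoc_of% hcι]
        simp [σ, k₁, k₂, f'])
    have hwι : w ≫ ι = 𝟙 _ := by
      have h₃ := hw₂ =≫ prod.fst
      have h₄ := hw₂ =≫ prod.snd
      simp only [Category.assoc, reassoc_of% hdι, reassoc_of% hcι] at hw₁ h₃ h₄
      have hw₁' : w ≫ ι ≫ k₁ ≫ π = k₁ ≫ π := by
        rw [hw₁]; simp [k₁]
      have hw₂' := hw₁'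
      rw [hk] at hw₂'
      apply pullback.hom_ext <;> apply pullback.hom_ext
      · simpa [π] using hw₁'
      · simpa [b, σ, k₁, k₂, f'] using h₃
      · simpa [π] using hw₂'
      · simpa [b, σ, k₁, k₂, f'] using h₄
    have hφ : k₁ ≫ φ = k₂ ≫ φ := by
      have := w ≫= equalizer.condition (k₁ ≫ φ) (k₂ ≫ φ)
      change w ≫ ι ≫ _ = w ≫ ι ≫ _ at this
      simpa only [reassoc_of% hwι] using this
    -- `π` is a pullback of `q`, hence the coequalizer of its kernel pair.
    obtain ⟨ψ, hψ⟩ : ∃ ψ, π ≫ ψ = φ :=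
      
      IsRegularEpi.exists_of_isKernelPair π (.of_hasPullback π) φ hφ
    refine ⟨Hom.mk ψ ?_ ?_, ?_⟩
    · rw [← cancel_epi π, reassoc_of% hψ, hw, ← hgf]
      exact (Category.assoc _ _ _).trans
        ((Hom.hom g ≫= pullback.condition).trans (Category.assoc _ _ _).symm)
    · rw [← cancel_epi q, ← hgs, ← hψ, ← Category.assoc, ← pullbackSection_fst, Category.assoc]
    · apply hom_ext
      apply pullback.hom_ext
      · exact (pullbackHom_fst _ _).trans hψ
      · exact (pullbackHom_snd _ _).trans hgf.symm

/-- In a regular Mal'tsev category, base change of points along a regular epimorphism is saturated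
on subobjects. -/
theorem Pt.baseChange_saturatedOnSubobjects [Regular E] [IsMaltsev E] {Y' Y : E} (q : Y' ⟶ Y)
    [IsRegularEpi q] : SaturatedOnSubobjects (baseChange q) := by
  intro P Z n hn
  let ν : Z.X ⟶ pullback P.f q := Hom.hom n
  have : Mono ν := mono_hom n
  have hνf : ν ≫ pullback.snd P.f q = Z.f := Hom.hom_f n
  have hνs : Z.s ≫ ν = pullbackSection q P := Hom.s_hom n
  let π : pullback P.f q ⟶ P.X := pullback.fst P.f q
  -- The descended subobject `W` is the image of `Z` in `P.X`; its section comes from lifting the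
  -- strong epimorphism `q` against `F.m`.
  let F := Regular.strongEpiMonoFactorisation (ν ≫ π)
  have hF : F.e ≫ F.m = ν ≫ π := F.fac
  have hsq : CommSq (Z.s ≫ F.e) q F.m P.s := ⟨by
    rw [Category.assoc, hF, reassoc_of% hνs]
    exact pullbackSection_fst q P⟩
  let W : Pt Y :=
    { X := F.I
      f := F.m ≫ P.f
      s := hsq.lift
      s_f := by rw [← Category.assoc, hsq.fac_right, P.s_f] }
  let m : W ⟶ P := Hom.mk F.m rfl hsq.fac_right
  have hm : Mono m := ⟨fun g h w => hom_ext (by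
    rw [← cancel_mono F.m]; exact congrArg Hom.hom w)⟩
  have hmf : pullbackHom q m ≫ π = pullback.fst W.f q ≫ F.m := pullbackHom_fst q m
  have hms : pullbackHom q m ≫ pullback.snd P.f q = pullback.snd W.f q := pullbackHom_snd q m
  have hmm : Mono (pullbackHom q m) := ⟨fun g h w => by
    apply pullback.hom_ext
    · rw [← cancel_mono F.m, Category.assoc, Category.assoc, ← hmf, reassoc_of% w]
    · rw [← hms, reassoc_of% w]⟩
  let i : Z.X ⟶ pullback W.f q := pullback.lift F.e Z.f (by
    change F.e ≫ F.m ≫ P.f = _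
    rw [reassoc_of% hF, pullback.condition, reassoc_of% hνf])
  have hi : i ≫ pullbackHom q m = ν := by
    apply pullback.hom_ext
    · rw [Category.assoc]
      change i ≫ pullbackHom q m ≫ π = _
      rw [hmf]
      simp only [i, pullback.lift_fst_assoc]
      exact hF
    · rw [Category.assoc, hms, hνf]
      simp [i]
  -- `Z` is viewed as a relation between `P.X` and `Y'`.
  have hd : Difunctional (ν ≫ π) Z.f := IsMaltsev.difunctional _ _ ⟨fun V x y h₁ h₂ => by
    rw [← cancel_mono ν]
    apply pullback.hom_ext
    · simpa [π] using h₁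
    · simpa [hνf] using h₂⟩
  let a := pullback.fst F.e (pullback.fst W.f q)
  let c := pullback.snd F.e (pullback.fst W.f q)
  have hac : a ≫ F.e = c ≫ pullback.fst W.f q := pullback.condition
  let y := c ≫ pullback.snd W.f q
  have hs : Z.s ≫ ν ≫ π = q ≫ P.s := by
    rw [reassoc_of% hνs]; exact pullbackSection_fst q P
  have hay : (a ≫ Z.f) ≫ q = y ≫ q := by
    rw [← hνf, Category.assoc, Category.assoc, ← pullback.condition]
    simp only [y, Category.assoc]
    rw [← pullback.condition, ← reassoc_of% hac]
    change a ≫ ν ≫ π ≫ P.f = a ≫ F.e ≫ F.m ≫ P.f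
    rw [reassoc_of% hF]
  -- For `(x, y)` in `q^*W`, choose locally `a = (x, y₀)` in `Z`. Then `(x, y₀)`, `(s (q y₀), y₀)`
  -- and `(s (q y), y)` lie in `Z` and `q y₀ = q y`, so `(x, y)` lies in `Z`.
  obtain ⟨w, hw₁, hw₂⟩ := hd a ((a ≫ Z.f) ≫ Z.s) (y ≫ Z.s) (by simp)
    (by rw [Category.assoc, Category.assoc _ Z.s, hs, ← Category.assoc, hay, Category.assoc])
  have hwc : w ≫ ν = c ≫ pullbackHom q m := by
    apply pullback.hom_ext
    · change (w ≫ ν) ≫ π = (c ≫ pullbackHom q m) ≫ π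
      rw [Category.assoc, hw₁, Category.assoc, hmf, ← reassoc_of% hac, hF]
    · rw [Category.assoc, Category.assoc, hms, hνf, hw₂]
      simp [y]
  -- The local choice is removed by lifting `c`, a pullback of the regular epimorphism `F.e`,
  -- against the monomorphism `ν`.
  have hsq' : CommSq w c ν (pullbackHom q m) := ⟨hwc⟩
  let j : pullback W.f q ⟶ Z.X := hsq'.lift
  have hj : j ≫ ν = pullbackHom q m := hsq'.fac_right
  have his : Z.s ≫ i = pullbackSection q W := by
    rw [← cancel_mono (pullbackHom q m), Category.assoc, hi, hνs, pullbackSection_pullbackHom]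
  have hij : i ≫ j = 𝟙 _ := by rw [← cancel_mono ν, Category.assoc, hj, hi, Category.id_comp]
  have hji : j ≫ i = 𝟙 _ := by
    rw [← cancel_mono (pullbackHom q m), Category.assoc, hi, hj, Category.id_comp]
  let e : Z ≅ (baseChange q).obj W :=
    { hom := Hom.mk i (pullback.lift_snd _ _ _) his
      inv := Hom.mk j
        (by
          change j ≫ Z.f = pullback.snd W.f q
          rw [← hνf, reassoc_of% hj, hms])
        (by
          change pullbackSection q W ≫ j = Z.s
          rw [← his, Category.assoc, hij, Category.comp_id])
      hom_inv_id := hom_ext hij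
      inv_hom_id := hom_ext hji }
  exact ⟨W, m, e, hm, hom_ext hi⟩

/-! ### From saturation to difunctionality -/

/-- If base change of points along the first projection of a reflexive relation is saturated on
subobjects, then this relation is difunctional. -/
theorem ReflexiveRelation.difunctional [HasFiniteLimits E] {R X : E} {p₁ p₂ : R ⟶ X}
    (h : ReflexiveRelation p₁ p₂) (hs : SaturatedOnSubobjects (Pt.baseChange p₁)) :
    Difunctional p₁ p₂ := by
  -- `p₁^*P` consists of pairs `(r, x)`. Its subobject `ν` consists of those for which some `t` in
  -- `R` has `p₁ t = x` and `p₂ t = p₂ r`.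
  let P : Pt X := { X := X ⨯ X, f := prod.fst, s := diag X, s_f := by simp }
  let S : Pt R :=
    { X := pullback p₂ p₂
      f := pullback.fst p₂ p₂
      s := pullback.lift (𝟙 R) (𝟙 R) rfl
      s_f := by simp }
  let ν : pullback p₂ p₂ ⟶ pullback P.f p₁ :=
    pullback.lift (prod.lift (pullback.fst p₂ p₂ ≫ p₁) (pullback.snd p₂ p₂ ≫ p₁))
      (pullback.fst p₂ p₂) (by simp [P])
  have hν₁ : ν ≫ pullback.fst P.f p₁ = prod.lift (pullback.fst p₂ p₂ ≫ p₁)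
    (pullback.snd p₂ p₂ ≫ p₁) := pullback.lift_fst _ _ _
  have hν₂ : ν ≫ pullback.snd P.f p₁ = pullback.fst p₂ p₂ := pullback.lift_snd _ _ _
  let n : S ⟶ (Pt.baseChange p₁).obj P := Pt.Hom.mk ν hν₂ (by
    change pullback.lift (𝟙 R) (𝟙 R) rfl ≫ ν = Pt.pullbackSection p₁ P
    apply pullback.hom_ext
    · rw [Category.assoc, hν₁, Pt.pullbackSection_fst]
      apply Limits.prod.hom_ext <;> simp [P]
    · rw [Category.assoc, hν₂, Pt.pullbackSection_snd]
      simp)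
  have hνm : Mono ν := ⟨fun x y w => by
    have w₁ := w =≫ pullback.snd P.f p₁
    have w₂ := w =≫ (pullback.fst P.f p₁ ≫ prod.snd)
    simp only [Category.assoc, hν₂] at w₁
    simp only [Category.assoc, reassoc_of% hν₁, prod.lift_snd] at w₂
    refine pullback.hom_ext w₁ (h.right_cancellation _ _ (by simpa using w₂) ?_)
    simp only [Category.assoc, ← pullback.condition, reassoc_of% w₁]⟩
  have hn : Mono n := ⟨fun x y w => Pt.hom_ext (by
    rw [← cancel_mono ν]; exact congrArg Pt.Hom.hom w)⟩
  -- Membership of `(r, x)` in this subobject now means that `(p₁ r, x)` lies in `W`, so it depends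
  -- only on `p₁ r` and `x`.
  obtain ⟨W, m, e, -, he⟩ := hs P S n hn
  let i : pullback p₂ p₂ ⟶ pullback W.f p₁ := Pt.Hom.hom e.hom
  let j : pullback W.f p₁ ⟶ pullback p₂ p₂ := Pt.Hom.hom e.inv
  have hji : j ≫ i = 𝟙 _ := congrArg Pt.Hom.hom e.inv_hom_id
  have hi : i ≫ Pt.pullbackHom p₁ m = ν := congrArg Pt.Hom.hom he
  have hif : i ≫ pullback.snd W.f p₁ = pullback.fst p₂ p₂ := Pt.Hom.hom_f e.hom
  have hjf : j ≫ pullback.fst p₂ p₂ = pullback.snd W.f p₁ := Pt.Hom.hom_f e.inv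
  have hj : j ≫ ν = Pt.pullbackHom p₁ m := by rw [← hi, reassoc_of% hji]
  intro Z t r r' hr hr'
  let x : Z ⟶ pullback p₂ p₂ := pullback.lift r t hr.symm
  -- `(r, p₁ t)` is in the subobject, witnessed by `t`. Since `p₁ r = p₁ r'`, so is `(r', p₁ t)`,
  -- and its witness is the required element.
  let z : Z ⟶ pullback W.f p₁ := pullback.lift (x ≫ i ≫ pullback.fst W.f p₁) r' (by
    simp only [Category.assoc]
    rw [pullback.condition, reassoc_of% hif]
    simpa [x] using hr')
  refine ⟨z ≫ j ≫ pullback.snd p₂ p₂, ?_, ?_⟩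
  · have h₁ : ν ≫ pullback.fst P.f p₁ ≫ prod.snd = pullback.snd p₂ p₂ ≫ p₁ := by
      rw [reassoc_of% hν₁, prod.lift_snd]
    simp only [Category.assoc]
    rw [← h₁, reassoc_of% hj, ← Category.assoc (Pt.pullbackHom p₁ m), Pt.pullbackHom_fst]
    simp only [z, pullback.lift_fst_assoc, Category.assoc]
    rw [← Category.assoc (pullback.fst W.f p₁), ← Pt.pullbackHom_fst, Category.assoc,
      reassoc_of% hi, h₁]
    simp [x]
  · simp only [Category.assoc]
    rw [← pullback.condition, reassoc_of% hjf]
    simp [z]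

end MaltsevCat

theorem mainTheorem7 (E : Type u) [Category.{v} E] [Regular E] :
    MaltsevCat.IsMaltsev E ↔
      ∀ {Y' Y : E} (q : Y' ⟶ Y), IsRegularEpi q →
        (MaltsevCat.Pt.baseChange q).Full ∧ (MaltsevCat.Pt.baseChange q).Faithful ∧
          MaltsevCat.SaturatedOnSubobjects (MaltsevCat.Pt.baseChange q) := by
  constructor
  · intro _ Y' Y q _
    exact ⟨MaltsevCat.Pt.baseChange_full q, MaltsevCat.Pt.baseChange_faithful q,
      MaltsevCat.Pt.baseChange_saturatedOnSubobjects q⟩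
  · intro H
    refine { toHasFiniteLimits := inferInstance, isEquivalenceRelation := fun p₁ p₂ h => ?_ }
    -- Reflexivity splits `p₁`, so it is a regular epimorphism and the hypothesis applies.
    have : IsSplitEpi p₁ := ⟨⟨h.r, h.reflexivity₁⟩⟩
    exact (MaltsevCat.ReflexiveRelation.difunctional h
      (H p₁ inferInstance).2.2).isEquivalenceRelation h
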